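/- **Definitions.** Fix $n\ge 0$ and embed the disk $D^2=[0,1]\times[0,1]\subset\mathbb R^2$ in $S^2$ by inverse stereographic projection. A *permutation chart of degree $n$* is a finite graph embedded in $D^2$ (edges may be loops, and vertex-free simple closed curves are allowed as edges), with edges labelled by elements of $\{1,\dots,n-1\}$, each of whose vertices is either a *black vertex* (of valence 1), a *crossing* (of valence 4, with labels $i,j,i,j$ in cyclic order, $|i-j|>1$), or a *white vertex* (of valence 6, with labels $i,i+1,i,i+1,i,i+1$ in cyclic order). A *semi-oriented chart* $\Gamma^*$ is a graph of the same kind that may also have bivalent vertices (whose two incident edges have the same label), with an orientation of every edge, such that every bivalent vertex is a source or a sink, at every crossing opposite edges are consistently oriented, and at every white vertex three consecutive edges are incoming and the other three are outgoing. It is a *semi-orientation* of a permutation chart $\Gamma$ if it is obtained from $\Gamma$ by adding bivalent vertices on edges and orienting the resulting edges. An *$n$-fold simple branched cover* of $S^2$ is a closed smooth surface $M$ with a surjective map $f:M\to S^2$ such that every point of $S^2$ is either a *regular point*, having a neighbourhood $N$ for which $f^{-1}(N)$ is a disjoint union of $n$ open sets carried diffeomorphically onto $N$, or a *branch point*, having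 a neighbourhood $N$ for which $f^{-1}(N)$ is a disjoint union of $n-1$ open sets, $n-2$ of which are carried diffeomorphically onto $N$ while on the last one $f$ is $(x_1,x_2)\mapsto(x_1^2-x_2^2,2x_1x_2)$ in smooth coordinates. It is *associated with* a labelled graph $\Gamma\subset D^2\subset S^2$ as above (for instance a semi-oriented chart) if its branch points are exactly the black vertices, and $M$ is obtained from $n$ numbered copies of $S^2$, cut along $\Gamma$, by gluing them across each edge with label $k$ through the transposition $(k\ \,k+1)$; that is, $f$ is trivialized by $n$ numbered sheets over $S^2\setminus\Gamma$, and crossing an edge with label $k$ exchanges the sheets $k$ and $k+1$ and preserves the others. **Statement.** 1. Every permutation chart has a semi-orientation. 2. Let $\Gamma^*$ be a semi-oriented chart of degree $n$ and let $F:\hat M^2(\Gamma^*)\to S^2$ be the associated $n$-fold simple branched cover. Then there is a smooth immersion $\tilde F:\hat M^2(\Gamma^*)\to S^2\times[0,1]\times[0,1]$ such that $p\circ\tilde F=F$, where $p$ is the projection onto the first factor. 3. For every $3$-fold simple branched cover $f:M^2\to S^2$ there is a smooth immersion $\tilde f:M^2\to S^2\times D^2$ such that $p\circ\tilde f=f$,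 where $p$ is the projection onto the first factor. -/

import Mathlib

open scoped Manifold ContDiff

namespace Folding

/-! ### Charts -/

/-- The unit square `[0,1] × [0,1]` in the plane. -/
def unitSquare : Set ℂ := {z | z.re ∈ Set.Icc (0 : ℝ) 1 ∧ z.im ∈ Set.Icc (0 : ℝ) 1}

/-- A finite graph embedded in the disk `[0,1] × [0,1]`, with edges labelled by `1, …, n - 1`.
An edge is an embedded arc whose two ends are vertices (they may be the same vertex), or a simple
closed curve without vertices. Each edge comes with a parametrization by `[0,1]`; the values of
`arc e` outside `[0,1]` are irrelevant. -/
structure LabelledGraph (n : ℕ) where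
  vertices : Finset ℂ
  Edge : Type
  finite_edge : Finite Edge
  arc : Edge → ℝ → ℂ
  label : Edge → ℕ
  vertices_mem : ∀ v ∈ vertices, v ∈ unitSquare
  arc_mem : ∀ e, ∀ t ∈ Set.Icc (0 : ℝ) 1, arc e t ∈ unitSquare
  arc_continuousOn : ∀ e, ContinuousOn (arc e) (Set.Icc 0 1)
  /-- Only the two ends of an edge may coincide. -/
  arc_injective : ∀ e, ∀ s ∈ Set.Icc (0 : ℝ) 1, ∀ t ∈ Set.Icc (0 : ℝ) 1,
    arc e s = arc e t → s = t ∨ (s = 0 ∧ t = 1) ∨ (s = 1 ∧ t = 0)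
  arc_interior : ∀ e, ∀ t ∈ Set.Ioo (0 : ℝ) 1, arc e t ∉ vertices
  arc_ends : ∀ e, (arc e 0 ∈ vertices ∧ arc e 1 ∈ vertices) ∨
    (arc e 0 = arc e 1 ∧ arc e 0 ∉ vertices)
  /-- Different edges meet at vertices only. -/
  arc_disjoint : ∀ e e', e ≠ e' → ∀ s ∈ Set.Icc (0 : ℝ) 1, ∀ t ∈ Set.Icc (0 : ℝ) 1,
    arc e s = arc e' t → arc e s ∈ vertices
  label_pos : ∀ e, 1 ≤ label e
  label_lt : ∀ e, label e < n

namespace LabelledGraph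

variable {n : ℕ} (Γ : LabelledGraph n)

/-- The underlying point set of an edge. -/
def edgeSet (e : Γ.Edge) : Set ℂ := Γ.arc e '' Set.Icc 0 1

/-- The underlying point set of the graph. -/
def support : Set ℂ := (Γ.vertices : Set ℂ) ∪ ⋃ e, Γ.edgeSet e

/-- A half-edge: an edge together with one of its two ends, `false` being the end at
parameter `0` and `true` the end at parameter `1`. -/
abbrev HalfEdge : Type := Γ.Edge × Bool

/-- A half-edge, parametrized starting from its end. -/
def germ (h : Γ.HalfEdge) (t : ℝ) : ℂ := Γ.arc h.1 (if h.2 then 1 - t else t)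

/-- The half-edges at `v`; their number is the valence of `v`. -/
def halfEdgesAt (v : ℂ) : Set Γ.HalfEdge := {h | Γ.germ h 0 = v}

/-- The half-edges at `v` are `h 0, …, h (k - 1)`, without repetition. -/
def IsStar {k : ℕ} (v : ℂ) (h : Fin k → Γ.HalfEdge) : Prop :=
  Function.Injective h ∧ Set.range h = Γ.halfEdgesAt v

/-- The half-edges `h 0, …, h (k - 1)` leave `v` in this cyclic order (up to a reflection): some
homeomorphism from a neighbourhood of `v` to a neighbourhood of `0` carries their initial parts
into the rays from `0` at the angles `2πj/k`. -/
def InCyclicOrder {k : ℕ} (v : ℂ) (h : Fin k → Γ.HalfEdge) : Prop :=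
  ∃ φ : OpenPartialHomeomorph ℂ ℂ, v ∈ φ.source ∧ φ v = 0 ∧
    ∀ j : Fin k, ∃ ε > (0 : ℝ), ∀ t ∈ Set.Ioo 0 ε, ∃ r > (0 : ℝ),
      φ (Γ.germ (h j) t) = r * Complex.exp (2 * Real.pi * (j : ℕ) / (k : ℕ) * Complex.I)

/-- A black vertex: a vertex of valence one. -/
def IsBlack (v : ℂ) : Prop :=
  v ∈ Γ.vertices ∧ ∃ h : Fin 1 → Γ.HalfEdge, Γ.IsStar v h

/-- `v` is a crossing, with half-edges `h 0, …, h 3` in cyclic order. -/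
def IsCrossing (v : ℂ) (h : Fin 4 → Γ.HalfEdge) : Prop :=
  v ∈ Γ.vertices ∧ Γ.IsStar v h ∧ Γ.InCyclicOrder v h ∧
    ∃ i j : ℕ, (i + 1 < j ∨ j + 1 < i) ∧
      ∀ k : Fin 4, Γ.label (h k).1 = if (k : ℕ) % 2 = 0 then i else j

/-- `v` is a white vertex, with half-edges `h 0, …, h 5` in cyclic order. -/
def IsWhite (v : ℂ) (h : Fin 6 → Γ.HalfEdge) : Prop :=
  v ∈ Γ.vertices ∧ Γ.IsStar v h ∧ Γ.InCyclicOrder v h ∧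
    ∃ i : ℕ, ∀ k : Fin 6, Γ.label (h k).1 = if (k : ℕ) % 2 = 0 then i else i + 1

/-- `v` is a bivalent vertex, with half-edges `h 0, h 1` of the same label. -/
def IsBivalent (v : ℂ) (h : Fin 2 → Γ.HalfEdge) : Prop :=
  v ∈ Γ.vertices ∧ Γ.IsStar v h ∧ Γ.label (h 0).1 = Γ.label (h 1).1

end LabelledGraph

/-- A permutation chart of degree `n`. -/
structure PermutationChart (n : ℕ) extends LabelledGraph n where
  vertex_type : ∀ v ∈ vertices, toLabelledGraph.IsBlack v ∨
    (∃ h, toLabelledGraph.IsCrossing v h) ∨ ∃ h, toLabelledGraph.IsWhite v h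

namespace LabelledGraph

variable {n : ℕ} (Γ : LabelledGraph n)

/-- Orientations of the edges are given by `o : Γ.Edge → Bool`, where `true` means that the edge
is directed from parameter `0` to parameter `1`, and `false` the opposite. The half-edge `h` then
points towards its end (is incoming) if and only if `Incoming o h`. -/
def Incoming (o : Γ.Edge → Bool) (h : Γ.HalfEdge) : Prop := o h.1 = h.2

/-- There is a flow through the crossing with half-edges `h 0, …, h 3`: opposite edges are
consistently oriented. -/
def CrossingFlow (o : Γ.Edge → Bool) (h : Fin 4 → Γ.HalfEdge) : Prop :=
  (Γ.Incoming o (h 0) ↔ ¬ Γ.Incoming o (h 2)) ∧ (Γ.Incoming o (h 1) ↔ ¬ Γ.Incoming o (h 3))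

/-- There is a flow through the white vertex with half-edges `h 0, …, h 5`: three consecutive
half-edges are incoming, and the other three are outgoing. -/
def WhiteFlow (o : Γ.Edge → Bool) (h : Fin 6 → Γ.HalfEdge) : Prop :=
  ∃ c : Fin 6, ∀ k : Fin 6, Γ.Incoming o (h (c + k)) ↔ (k : ℕ) < 3

/-- The bivalent vertex with half-edges `h 0, h 1` is a source. -/
def IsSource (o : Γ.Edge → Bool) (h : Fin 2 → Γ.HalfEdge) : Prop :=
  ¬ Γ.Incoming o (h 0) ∧ ¬ Γ.Incoming o (h 1)

/-- The bivalent vertex with half-edges `h 0, h 1` is a sink. -/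
def IsSink (o : Γ.Edge → Bool) (h : Fin 2 → Γ.HalfEdge) : Prop :=
  Γ.Incoming o (h 0) ∧ Γ.Incoming o (h 1)

end LabelledGraph

/-- A semi-oriented chart of degree `n`. -/
structure SemiOrientedChart (n : ℕ) extends LabelledGraph n where
  orient : Edge → Bool
  vertex_type : ∀ v ∈ vertices, toLabelledGraph.IsBlack v ∨
    (∃ h, toLabelledGraph.IsCrossing v h ∧ toLabelledGraph.CrossingFlow orient h) ∨
    (∃ h, toLabelledGraph.IsWhite v h ∧ toLabelledGraph.WhiteFlow orient h) ∨
    ∃ h, toLabelledGraph.IsBivalent v h ∧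
      (toLabelledGraph.IsSource orient h ∨ toLabelledGraph.IsSink orient h)

/-- The semi-oriented chart `Γ'` is obtained from the permutation chart `Γ` by adding bivalent
vertices on edges and orienting the resulting edges. -/
def IsSemiOrientationOf {n : ℕ} (Γ' : SemiOrientedChart n) (Γ : PermutationChart n) : Prop :=
  Γ'.support = Γ.support ∧
  Γ.vertices ⊆ Γ'.vertices ∧
  (∀ v ∈ Γ'.vertices, v ∉ Γ.vertices → ∃ h, Γ'.IsBivalent v h) ∧
  ∀ e', ∃ e, Γ'.edgeSet e' ⊆ Γ.edgeSet e ∧ Γ'.label e' = Γ.label e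

/-! ### Simple branched covers of the sphere -/

/-- The unit sphere in three-space, with the smooth structure that Mathlib puts on it. -/
abbrev S2 : Type := Metric.sphere (0 : EuclideanSpace ℝ (Fin 3)) 1

/-- Inverse stereographic projection. It fixes an embedding of the square in the sphere. -/
noncomputable def toSphere (z : ℂ) : S2 :=
  ⟨!₂[2 * z.re / (z.re ^ 2 + z.im ^ 2 + 1), 2 * z.im / (z.re ^ 2 + z.im ^ 2 + 1),
      (z.re ^ 2 + z.im ^ 2 - 1) / (z.re ^ 2 + z.im ^ 2 + 1)], by
    have h : z.re ^ 2 + z.im ^ 2 + 1 ≠ 0 := by positivity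
    rw [mem_sphere_zero_iff_norm, EuclideanSpace.norm_eq, Real.sqrt_eq_one]
    simp only [Fin.sum_univ_three, Real.norm_eq_abs, sq_abs]
    simp
    field_simp
    ring⟩

section Covers

variable {M : Type*} [TopologicalSpace M] [ChartedSpace (EuclideanSpace ℝ (Fin 2)) M]

/-- `f` restricts to a diffeomorphism from the open set `U` onto the open set `N`. -/
def DiffeoOn (f : M → S2) (U : Set M) (N : Set S2) : Prop :=
  ∃ Φ : PartialDiffeomorph (𝓡 2) (𝓡 2) M S2 ∞,
    Φ.source = U ∧ Φ.target = N ∧ Set.EqOn f Φ U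

/-- `y` has an open neighbourhood `N` whose preimage is the disjoint union of `n` open sets, each
of which is carried diffeomorphically onto `N`. -/
def IsRegularPoint (n : ℕ) (f : M → S2) (y : S2) : Prop :=
  ∃ N : Set S2, IsOpen N ∧ y ∈ N ∧ ∃ U : Fin n → Set M,
    f ⁻¹' N = ⋃ j, U j ∧ Pairwise (fun i j => Disjoint (U i) (U j)) ∧
    ∀ j, DiffeoOn f (U j) N

/-- `y` has an open neighbourhood `N` whose preimage is the disjoint union of `n - 1` open sets:
`n - 2` of them are carried diffeomorphically onto `N`, and on the last one, `f` is `z ↦ z ^ 2` in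
suitable smooth coordinates, that is, `(x₁, x₂) ↦ (x₁ ^ 2 - x₂ ^ 2, 2 x₁ x₂)`. -/
def IsBranchPoint (n : ℕ) (f : M → S2) (y : S2) : Prop :=
  2 ≤ n ∧ ∃ N : Set S2, IsOpen N ∧ y ∈ N ∧ ∃ (U : Fin (n - 2) → Set M) (W : Set M),
    f ⁻¹' N = (⋃ j, U j) ∪ W ∧ Pairwise (fun i j => Disjoint (U i) (U j)) ∧
    (∀ j, Disjoint (U j) W) ∧ (∀ j, DiffeoOn f (U j) N) ∧
    ∃ (φ : PartialDiffeomorph (𝓡 2) 𝓘(ℝ, ℂ) S2 ℂ ∞) (ψ : PartialDiffeomorph (𝓡 2) 𝓘(ℝ, ℂ) M ℂ ∞),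
      φ.source = N ∧ φ.target = Metric.ball 0 1 ∧ φ y = 0 ∧
      ψ.source = W ∧ ψ.target = Metric.ball 0 1 ∧
      ∀ x ∈ W, φ (f x) = (ψ x) ^ 2

/-- `f` is an `n`-fold simple branched cover of the sphere (in the smooth category). The surface
`M` is compact Hausdorff wherever this is used; it is then orientable, since the sphere is. -/
def IsSimpleBranchedCover (n : ℕ) (f : M → S2) : Prop :=
  Function.Surjective f ∧ ∀ y, IsRegularPoint n f y ∨ IsBranchPoint n f y

/-- The transposition `(k  k+1)` of `{1, …, n}`, where the letter `i` is the element `i - 1` of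
`Fin n`; it is defined for `1 ≤ k < n` (and taken to be the identity otherwise). -/
def transposition (n k : ℕ) : Equiv.Perm (Fin n) :=
  if h : 1 ≤ k ∧ k < n then
    Equiv.swap ⟨k - 1, by omega⟩ ⟨k, h.2⟩
  else 1

/-- `f : M → S²` is (up to equivalence) the `n`-fold simple branched cover associated with `Γ`:
its branch points are the black vertices, and it is obtained from `n` numbered copies of the sphere,
cut along `Γ`, by gluing them across each edge with label `k` through the transposition
`(k  k+1)`.  Here `s i` is the copy with number `i`, defined off `Γ`; at a point of an edge, `t` are
the local sheets of the cover, and `A`, `B` are the two sides of the edge. Off the vertices the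
monodromy is therefore given by the intersection words with `Γ`, and outside of the disk the cover
is trivial. -/
def IsAssociatedCover {n : ℕ} (Γ : LabelledGraph n) (f : M → S2) : Prop :=
  IsSimpleBranchedCover n f ∧
  (∀ y, IsBranchPoint n f y ↔ ∃ v, Γ.IsBlack v ∧ toSphere v = y) ∧
  ∃ s : Fin n → S2 → M,
    (∀ i, ContinuousOn (s i) (toSphere '' Γ.support)ᶜ) ∧
    (∀ y ∉ toSphere '' Γ.support, Set.BijOn (fun i => s i y) Set.univ (f ⁻¹' {y})) ∧
    ∀ e, ∀ r ∈ Set.Icc (0 : ℝ) 1, Γ.arc e r ∉ Γ.vertices →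
      ∃ (N A B : Set S2) (t : Fin n → S2 → M),
        IsOpen N ∧ toSphere (Γ.arc e r) ∈ N ∧
        IsOpen A ∧ IsOpen B ∧ Disjoint A B ∧ A ∪ B = N \ toSphere '' Γ.support ∧
        toSphere (Γ.arc e r) ∈ closure A ∧ toSphere (Γ.arc e r) ∈ closure B ∧
        (∀ i, ContinuousOn (t i) N) ∧ (∀ i, ∀ y ∈ N, f (t i y) = y) ∧
        (∀ i, ∀ y ∈ A, t i y = s i y) ∧
        ∀ i, ∀ y ∈ B, t i y = s (transposition n (Γ.label e) i) y

/-- `F` is a smooth immersion of `M` into `S² × V` which lifts `f`, with values in `S² × K`. -/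
def IsImmersedFolding {V : Type} [NormedAddCommGroup V] [NormedSpace ℝ V]
    (f : M → S2) (K : Set V) (F : M → S2 × V) : Prop :=
  Manifold.IsImmersion (𝓡 2) ((𝓡 2).prod 𝓘(ℝ, V)) ∞ F ∧
  (∀ x, (F x).1 = f x) ∧ ∀ x, (F x).2 ∈ K

end Covers

end Folding

/-! Semi-orientations: a flow is prescribed at each vertex separately
(`PermutationChart.exists_flow`), so each end of an edge with vertices receives a direction. When
the two ends of an edge are compatible, the edge is oriented accordingly; when both are incoming or
both outgoing, a bivalent vertex at the midpoint absorbs the conflict as a source or a sink. What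
has to be checked is that cutting edges at midpoints (`subdivide`) leaves the stars of the old
vertices intact.

Immersions: both statements are instances of `IsSimpleBranchedCover.exists_immersedFolding`. A
simple branched cover `f` is smooth, and since the sphere is compact, it is a local diffeomorphism
off a finite set `C`. A sum of charts cut off by bump functions gives a smooth `g` from the surface
to the plane that is a local diffeomorphism at every point of `C`. Then `(f, g)` is an immersion:
off `C` because of `f`, on `C` because of `g`. As the surface is compact, an affine rescaling of `g`
moves its image into any plane region with nonempty interior. -/

namespace Folding

/-! ### Cutting edges of a labelled graph at their midpoints -/

namespace LabelledGraph

variable {n : ℕ} (Γ : LabelledGraph n)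

/-- The parametrization of the pieces of an edge that is cut at its midpoint when it lies in `S`;
the second component of `p` tells the two halves apart. -/
noncomputable def pieceParam (S : Set Γ.Edge) (p : Γ.Edge × Bool) (t : ℝ) : ℝ :=
  open Classical in if p.1 ∈ S then (if p.2 then (1 + t) / 2 else t / 2) else t

/-- The pieces of the edges of `Γ` after the edges in `S` are cut at their midpoints. -/
abbrev Piece (S : Set Γ.Edge) : Type := {p : Γ.Edge × Bool // p.2 = true → p.1 ∈ S}

variable {Γ}

lemma mem_halfEdgesAt {v : ℂ} {x : Γ.HalfEdge} : x ∈ Γ.halfEdgesAt v ↔ Γ.germ x 0 = v := Iff.rfl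

section pieceParam

variable {S : Set Γ.Edge}

lemma continuous_pieceParam (p : Γ.Edge × Bool) : Continuous (Γ.pieceParam S p) := by
  unfold pieceParam
  split_ifs <;> fun_prop

lemma pieceParam_mem_Icc (p : Γ.Edge × Bool) {t : ℝ} (ht : t ∈ Set.Icc (0 : ℝ) 1) :
    Γ.pieceParam S p t ∈ Set.Icc (0 : ℝ) 1 := by
  obtain ⟨h0, h1⟩ := ht
  unfold pieceParam
  split_ifs <;> constructor <;> linarith

lemma pieceParam_mem_Ioo (p : Γ.Edge × Bool) {t : ℝ} (ht : t ∈ Set.Ioo (0 : ℝ) 1) :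
    Γ.pieceParam S p t ∈ Set.Ioo (0 : ℝ) 1 := by
  obtain ⟨h0, h1⟩ := ht
  unfold pieceParam
  split_ifs <;> constructor <;> linarith

lemma pieceParam_injective (p : Γ.Edge × Bool) : Function.Injective (Γ.pieceParam S p) := by
  intro s t h
  unfold pieceParam at h
  split_ifs at h <;> linarith

lemma pieceParam_ne_half (p : Γ.Edge × Bool) (hp : p.1 ∈ S) {t : ℝ} (ht : t ∈ Set.Ioo (0 : ℝ) 1) :
    Γ.pieceParam S p t ≠ 1 / 2 := by
  obtain ⟨h0, h1⟩ := ht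
  unfold pieceParam
  split_ifs <;> intro h <;> linarith

/-- Half of a cut edge never reaches both parameters `0` and `1`. Hence only an uncut edge can close
up, and it does so at its ends. -/
lemma pieceParam_ends (p : Γ.Edge × Bool) {s t : ℝ} (hs : s ∈ Set.Icc (0 : ℝ) 1)
    (ht : t ∈ Set.Icc (0 : ℝ) 1) (h0 : Γ.pieceParam S p s = 0) (h1 : Γ.pieceParam S p t = 1) :
    s = 0 ∧ t = 1 := by
  obtain ⟨hs0, hs1⟩ := hs
  obtain ⟨ht0, ht1⟩ := ht
  unfold pieceParam at h0 h1
  split_ifs at h0 h1 <;> constructor <;> linarith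

/-- An uncut edge has a single piece, the one tagged `false`. -/
lemma piece_mem_of_ne {p q : Γ.Piece S} (hpq : p ≠ q) (he : p.1.1 = q.1.1) : p.1.1 ∈ S := by
  obtain ⟨⟨e, b⟩, hp⟩ := p
  obtain ⟨⟨e', b'⟩, hq⟩ := q
  simp only at he
  subst he
  cases b <;> cases b' <;> simp_all

lemma pieceParam_eq_half {p q : Γ.Piece S} (hpq : p ≠ q) (he : p.1.1 = q.1.1) {s t : ℝ}
    (hs : s ∈ Set.Icc (0 : ℝ) 1) (ht : t ∈ Set.Icc (0 : ℝ) 1)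
    (h : Γ.pieceParam S p.1 s = Γ.pieceParam S q.1 t) : Γ.pieceParam S p.1 s = 1 / 2 := by
  have hS := piece_mem_of_ne hpq he
  obtain ⟨⟨e, b⟩, hp⟩ := p
  obtain ⟨⟨e', b'⟩, hq⟩ := q
  simp only at he
  subst he
  obtain ⟨hs0, hs1⟩ := hs
  obtain ⟨ht0, ht1⟩ := ht
  simp only at hS
  cases b <;> cases b' <;> simp_all [pieceParam] <;> linarith

end pieceParam

/-- The midpoint of an edge. -/
noncomputable def mid (e : Γ.Edge) : ℂ := Γ.arc e (1 / 2)

lemma mid_notMem_vertices (e : Γ.Edge) : mid e ∉ Γ.vertices :=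
  Γ.arc_interior e _ (by norm_num)

/-- Distinct edges share only vertices, and a midpoint is not one; on a single edge, the only
failure of injectivity is at the parameters `0` and `1`. -/
lemma eq_of_arc_eq_mid {e e' : Γ.Edge} {t : ℝ} (ht : t ∈ Set.Icc (0 : ℝ) 1)
    (h : Γ.arc e t = mid e') : e = e' ∧ t = 1 / 2 := by
  have hh : (1 / 2 : ℝ) ∈ Set.Icc (0 : ℝ) 1 := by norm_num
  have he : e = e' := by
    by_contra hne
    have := Γ.arc_disjoint e e' hne t ht (1 / 2) hh h
    rw [h] at this
    exact mid_notMem_vertices e' this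
  subst he
  refine ⟨rfl, ?_⟩
  rcases Γ.arc_injective e t ht (1 / 2) hh h with h | h | h
  · exact h
  · norm_num at h
  · norm_num at h

variable (Γ)

/-- The graph obtained by adding a bivalent vertex at the midpoint of each edge in `S`. -/
noncomputable def subdivide (S : Set Γ.Edge)
    (hS : ∀ e ∈ S, Γ.arc e 0 ∈ Γ.vertices ∧ Γ.arc e 1 ∈ Γ.vertices) : LabelledGraph n :=
  have := Γ.finite_edge
  { vertices := open Classical in Γ.vertices ∪ (Set.toFinite (mid '' S)).toFinset
    Edge := Γ.Piece S
    finite_edge := inferInstance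
    arc := fun p t => Γ.arc p.1.1 (Γ.pieceParam S p.1 t)
    label := fun p => Γ.label p.1.1
    vertices_mem := by
      intro v hv
      simp only [Finset.mem_union, Set.Finite.mem_toFinset, Set.mem_image] at hv
      rcases hv with hv | ⟨e, -, rfl⟩
      · exact Γ.vertices_mem v hv
      · exact Γ.arc_mem e _ (by norm_num)
    arc_mem := fun p t ht => Γ.arc_mem _ _ (pieceParam_mem_Icc _ ht)
    arc_continuousOn := fun p => (Γ.arc_continuousOn p.1.1).comp
      (continuous_pieceParam _).continuousOn fun t ht => pieceParam_mem_Icc _ ht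
    arc_injective := by
      intro p s hs t ht h
      rcases Γ.arc_injective _ _ (pieceParam_mem_Icc _ hs) _ (pieceParam_mem_Icc _ ht) h with
        h | ⟨h, h'⟩ | ⟨h, h'⟩
      · exact Or.inl (pieceParam_injective _ h)
      · exact Or.inr (Or.inl (pieceParam_ends _ hs ht h h'))
      · exact Or.inr (Or.inr (pieceParam_ends _ ht hs h' h).symm)
    arc_interior := by
      intro p t ht hv
      simp only [Finset.mem_union, Set.Finite.mem_toFinset, Set.mem_image] at hv
      rcases hv with hv | ⟨e, he, h⟩
      · exact Γ.arc_interior _ _ (pieceParam_mem_Ioo _ ht) hv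
      · obtain ⟨rfl, h'⟩ := eq_of_arc_eq_mid (pieceParam_mem_Icc _ (Set.Ioo_subset_Icc_self ht)) h.symm
        exact pieceParam_ne_half _ he ht h'
    arc_ends := by
      intro p
      simp only [Finset.mem_union, Set.Finite.mem_toFinset, Set.mem_image]
      by_cases hp : p.1.1 ∈ S
      · left
        have hm : ∃ e ∈ S, mid e = Γ.arc p.1.1 (1 / 2) := ⟨p.1.1, hp, rfl⟩
        cases hb : p.1.2
        · simpa [pieceParam, hp, hb, hS _ hp] using Or.inr hm
        · simpa [pieceParam, hp, hb, hS _ hp] using Or.inr hm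
      · simp only [pieceParam, hp, if_false]
        rcases Γ.arc_ends p.1.1 with ⟨h0, h1⟩ | ⟨h0, h1⟩
        · exact Or.inl ⟨Or.inl h0, Or.inl h1⟩
        · refine Or.inr ⟨h0, ?_⟩
          rintro (h | ⟨e, he, h⟩)
          · exact h1 h
          · have := (eq_of_arc_eq_mid (by norm_num) h.symm).2
            norm_num at this
    arc_disjoint := by
      intro p q hpq s hs t ht h
      simp only [Finset.mem_union, Set.Finite.mem_toFinset, Set.mem_image]
      -- The two halves of one edge meet at its midpoint and, if the edge is a loop, also at its
      -- common end; `hS` makes that end a vertex.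
      by_cases he : p.1.1 = q.1.1
      · have hpS := piece_mem_of_ne hpq he
        have h' : Γ.arc p.1.1 (Γ.pieceParam S p.1 s) = Γ.arc p.1.1 (Γ.pieceParam S q.1 t) := by
          rw [h, he]
        rcases Γ.arc_injective _ _ (pieceParam_mem_Icc _ hs) _ (pieceParam_mem_Icc _ ht) h' with
          h | ⟨h, -⟩ | ⟨h, -⟩
        · rw [pieceParam_eq_half hpq he hs ht h]
          exact Or.inr ⟨_, hpS, rfl⟩
        · rw [h]
          exact Or.inl (hS _ hpS).1
        · rw [h]
          exact Or.inl (hS _ hpS).2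
      · exact Or.inl
          (Γ.arc_disjoint _ _ he _ (pieceParam_mem_Icc _ hs) _ (pieceParam_mem_Icc _ ht) h)
    label_pos := fun p => Γ.label_pos _
    label_lt := fun p => Γ.label_lt _ }

section subdivide

variable {Γ} {S : Set Γ.Edge} {hS : ∀ e ∈ S, Γ.arc e 0 ∈ Γ.vertices ∧ Γ.arc e 1 ∈ Γ.vertices}

lemma mem_subdivide_vertices {v : ℂ} :
    v ∈ (Γ.subdivide S hS).vertices ↔ v ∈ Γ.vertices ∨ ∃ e ∈ S, mid e = v := by
  simp [subdivide]

lemma arc_subdivide (p : Γ.Piece S) (t : ℝ) :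
    (Γ.subdivide S hS).arc p t = Γ.arc p.1.1 (Γ.pieceParam S p.1 t) := rfl

lemma edgeSet_subdivide_subset (p : Γ.Piece S) :
    (Γ.subdivide S hS).edgeSet p ⊆ Γ.edgeSet p.1.1 := by
  rintro _ ⟨t, ht, rfl⟩
  exact ⟨_, pieceParam_mem_Icc _ ht, rfl⟩

lemma support_subdivide : (Γ.subdivide S hS).support = Γ.support := by
  apply Set.Subset.antisymm
  · rintro z (hz | hz)
    · rcases mem_subdivide_vertices.1 hz with hz | ⟨e, -, rfl⟩
      · exact Or.inl hz
      · exact Or.inr (Set.mem_iUnion.2 ⟨e, 1 / 2, by norm_num, rfl⟩)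
    · obtain ⟨p, hp⟩ := Set.mem_iUnion.1 hz
      exact Or.inr (Set.mem_iUnion.2 ⟨_, edgeSet_subdivide_subset p hp⟩)
  · rintro z (hz | hz)
    · exact Or.inl (mem_subdivide_vertices.2 (Or.inl hz))
    · obtain ⟨e, t, ⟨h0, h1⟩, rfl⟩ := Set.mem_iUnion.1 hz
      refine Or.inr (Set.mem_iUnion.2 ?_)
      by_cases he : e ∈ S
      · rcases le_total t (1 / 2) with h | h
        · refine ⟨⟨(e, false), by simp⟩, 2 * t, ⟨by linarith, by linarith⟩, ?_⟩
          rw [arc_subdivide]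
          simp [pieceParam, he]
        · refine ⟨⟨(e, true), fun _ => he⟩, 2 * t - 1, ⟨by linarith, by linarith⟩, ?_⟩
          rw [arc_subdivide]
          simp [pieceParam, he]
      · refine ⟨⟨(e, false), by simp⟩, t, ⟨h0, h1⟩, ?_⟩
        rw [arc_subdivide]
        simp [pieceParam, he]

variable (hS) in
/-- The half-edge of the subdivided graph at the end `c` of the piece `p`. -/
def pieceHalf (p : Γ.Piece S) (c : Bool) : (Γ.subdivide S hS).HalfEdge := (p, c)

lemma pieceHalf_inj {p q : Γ.Piece S} {c d : Bool} :
    pieceHalf hS p c = pieceHalf hS q d ↔ p = q ∧ c = d := Prod.ext_iff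

lemma germ_pieceHalf (p : Γ.Piece S) (c : Bool) (t : ℝ) :
    (Γ.subdivide S hS).germ (pieceHalf hS p c) t =
      Γ.arc p.1.1 (Γ.pieceParam S p.1 (if c then 1 - t else t)) := rfl

variable (S hS) in
/-- A half-edge of `Γ`, as a half-edge of the subdivided graph. -/
noncomputable def liftHalf (x : Γ.HalfEdge) : (Γ.subdivide S hS).HalfEdge :=
  open Classical in
  -- The end `x.2` of a cut edge is the end `x.2` of the half with the same tag; the opposite end of
  -- that half is the midpoint.
  if h : x.1 ∈ S then pieceHalf hS ⟨(x.1, x.2), fun _ => h⟩ x.2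
  else pieceHalf hS ⟨(x.1, false), by simp⟩ x.2

lemma liftHalf_of_mem {e : Γ.Edge} (he : e ∈ S) (b : Bool) :
    liftHalf S hS (e, b) = pieceHalf hS ⟨(e, b), fun _ => he⟩ b := by
  simp [liftHalf, he]

lemma liftHalf_of_notMem {e : Γ.Edge} (he : e ∉ S) (b : Bool) :
    liftHalf S hS (e, b) = pieceHalf hS ⟨(e, false), by simp⟩ b := by
  simp [liftHalf, he]

lemma liftHalf_injective : Function.Injective (liftHalf S hS) := by
  rintro ⟨e, b⟩ ⟨e', b'⟩ h
  unfold liftHalf at h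
  split_ifs at h <;> simp_all [pieceHalf_inj]
  grind

lemma label_liftHalf (x : Γ.HalfEdge) :
    (Γ.subdivide S hS).label (liftHalf S hS x).1 = Γ.label x.1 := by
  unfold liftHalf
  split_ifs <;> rfl

/-- Cutting only slows the parametrization down linearly: `c` is `1 / 2` on a cut edge and `1`
otherwise. This is what preserves endpoints and cyclic orders. -/
lemma germ_liftHalf (x : Γ.HalfEdge) :
    ∃ c ∈ Set.Ioc (0 : ℝ) 1, ∀ t, (Γ.subdivide S hS).germ (liftHalf S hS x) t = Γ.germ x (c * t) := by
  obtain ⟨e, b⟩ := x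
  by_cases he : e ∈ S
  · refine ⟨1 / 2, by norm_num, fun t => ?_⟩
    rw [liftHalf_of_mem he, germ_pieceHalf, germ]
    cases b
    · simp only [pieceParam, he, if_true, Bool.false_eq_true, if_false]
      congr 1; ring
    · simp only [pieceParam, he, if_true]
      congr 1; ring
  · refine ⟨1, by norm_num, fun t => ?_⟩
    rw [liftHalf_of_notMem he, germ_pieceHalf, germ]
    simp [pieceParam, he]

lemma germ_liftHalf_zero (x : Γ.HalfEdge) :
    (Γ.subdivide S hS).germ (liftHalf S hS x) 0 = Γ.germ x 0 := by
  obtain ⟨c, -, h⟩ := germ_liftHalf (hS := hS) x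
  simpa using h 0

/-- The half-edges of the subdivided graph come from half-edges of `Γ` or end at midpoints. -/
lemma halfEdge_subdivide (y : (Γ.subdivide S hS).HalfEdge) :
    (∃ x, liftHalf S hS x = y) ∨
      ∃ (e : Γ.Edge) (he : e ∈ S) (b : Bool), y = pieceHalf hS ⟨(e, b), fun _ => he⟩ !b := by
  obtain ⟨⟨⟨e, b⟩, hp⟩, c⟩ := y
  by_cases he : e ∈ S
  · by_cases hbc : b = c
    · subst hbc
      exact Or.inl ⟨(e, b), liftHalf_of_mem he b⟩
    · refine Or.inr ⟨e, he, b, ?_⟩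
      cases b <;> cases c <;> first | exact absurd rfl hbc | rfl
  · have hb : b = false := by
      cases b
      · rfl
      · exact absurd (hp rfl) he
    subst hb
    exact Or.inl ⟨(e, c), liftHalf_of_notMem he c⟩

lemma germ_mid {e : Γ.Edge} (he : e ∈ S) (b : Bool) :
    (Γ.subdivide S hS).germ (pieceHalf hS ⟨(e, b), fun _ => he⟩ !b) 0 = mid e := by
  rw [germ_pieceHalf]
  cases b <;> simp [pieceParam, he, mid]

lemma germ_zero_ne_mid (x : Γ.HalfEdge) (e : Γ.Edge) : Γ.germ x 0 ≠ mid e := by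
  intro h
  obtain ⟨e', b⟩ := x
  unfold germ at h
  have := (eq_of_arc_eq_mid (by cases b <;> simp) h).2
  cases b <;> norm_num at this

/-- The additional half-edges all end at midpoints, and lifting does not move the end of an old
half-edge. -/
lemma halfEdgesAt_subdivide {v : ℂ} (hv : v ∈ Γ.vertices) :
    (Γ.subdivide S hS).halfEdgesAt v = liftHalf S hS '' Γ.halfEdgesAt v := by
  ext y
  constructor
  · intro hy
    rcases halfEdge_subdivide y with ⟨x, rfl⟩ | ⟨e, he, b, rfl⟩
    · exact ⟨x, by rwa [mem_halfEdgesAt, germ_liftHalf_zero] at hy, rfl⟩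
    · rw [mem_halfEdgesAt, germ_mid] at hy
      exact absurd (hy ▸ hv) (mid_notMem_vertices e)
  · rintro ⟨x, hx, rfl⟩
    rw [mem_halfEdgesAt, germ_liftHalf_zero]
    exact hx

lemma IsStar.germ_zero {k : ℕ} {v : ℂ} {h : Fin k → Γ.HalfEdge} (hs : Γ.IsStar v h) (i : Fin k) :
    Γ.germ (h i) 0 = v := by
  rw [← mem_halfEdgesAt, ← hs.2]
  exact Set.mem_range_self i

lemma IsStar.subdivide {k : ℕ} {v : ℂ} {h : Fin k → Γ.HalfEdge} (hh : Γ.IsStar v h)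
    (hv : v ∈ Γ.vertices) : (Γ.subdivide S hS).IsStar v (liftHalf S hS ∘ h) := by
  refine ⟨liftHalf_injective.comp hh.1, ?_⟩
  rw [Set.range_comp, hh.2, halfEdgesAt_subdivide hv]

lemma InCyclicOrder.subdivide {k : ℕ} {v : ℂ} {h : Fin k → Γ.HalfEdge}
    (hh : Γ.InCyclicOrder v h) : (Γ.subdivide S hS).InCyclicOrder v (liftHalf S hS ∘ h) := by
  obtain ⟨φ, hv, h0, hφ⟩ := hh
  -- The same local homeomorphism and the same `ε` serve, because `c ≤ 1` keeps `c * t` below `ε`.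
  refine ⟨φ, hv, h0, fun j => ?_⟩
  obtain ⟨ε, hε, H⟩ := hφ j
  obtain ⟨c, ⟨hc0, hc1⟩, hc⟩ := germ_liftHalf (hS := hS) (h j)
  refine ⟨ε, hε, fun t ht => ?_⟩
  obtain ⟨r, hr, hr'⟩ := H (c * t) ⟨mul_pos hc0 ht.1, by nlinarith [ht.1, ht.2]⟩
  exact ⟨r, hr, by rw [Function.comp_apply, hc, hr']⟩

lemma IsBlack.subdivide {v : ℂ} (h : Γ.IsBlack v) : (Γ.subdivide S hS).IsBlack v :=
  ⟨mem_subdivide_vertices.2 (Or.inl h.1), _, h.2.choose_spec.subdivide h.1⟩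

lemma IsCrossing.subdivide {v : ℂ} {h : Fin 4 → Γ.HalfEdge} (hh : Γ.IsCrossing v h) :
    (Γ.subdivide S hS).IsCrossing v (liftHalf S hS ∘ h) := by
  obtain ⟨hv, hs, hc, i, j, hij, hl⟩ := hh
  exact ⟨mem_subdivide_vertices.2 (Or.inl hv), hs.subdivide hv, hc.subdivide, i, j, hij,
    fun k => (label_liftHalf _).trans (hl k)⟩

lemma IsWhite.subdivide {v : ℂ} {h : Fin 6 → Γ.HalfEdge} (hh : Γ.IsWhite v h) :
    (Γ.subdivide S hS).IsWhite v (liftHalf S hS ∘ h) := by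
  obtain ⟨hv, hs, hc, i, hl⟩ := hh
  exact ⟨mem_subdivide_vertices.2 (Or.inl hv), hs.subdivide hv, hc.subdivide, i,
    fun k => (label_liftHalf _).trans (hl k)⟩

lemma isBivalent_mid {e : Γ.Edge} (he : e ∈ S) :
    (Γ.subdivide S hS).IsBivalent (mid e)
      ![pieceHalf hS ⟨(e, false), fun _ => he⟩ true, pieceHalf hS ⟨(e, true), fun _ => he⟩ false] := by
  refine ⟨mem_subdivide_vertices.2 (Or.inr ⟨e, he, rfl⟩), ⟨?_, ?_⟩, rfl⟩
  · intro i j hij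
    fin_cases i <;> fin_cases j <;> simp_all [pieceHalf_inj]
  · apply Set.Subset.antisymm
    · rintro _ ⟨i, rfl⟩
      fin_cases i
      · exact germ_mid he false
      · exact germ_mid he true
    · intro y hy
      rcases halfEdge_subdivide y with ⟨x, rfl⟩ | ⟨e', he', b, rfl⟩
      · rw [mem_halfEdgesAt, germ_liftHalf_zero] at hy
        exact absurd hy (germ_zero_ne_mid x e)
      · rw [mem_halfEdgesAt, germ_mid] at hy
        obtain rfl := (eq_of_arc_eq_mid (by norm_num) hy).1
        cases b
        · exact ⟨0, rfl⟩
        · exact ⟨1, rfl⟩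

end subdivide

/-- Orientations of the pieces of the edges for which the half-edges `x` of `Γ` with `inc x = true`
become the incoming ones. -/
noncomputable def pieceOrient {S : Set Γ.Edge} (inc : Γ.HalfEdge → Bool) (p : Γ.Piece S) : Bool :=
  -- A half-edge with end `b` is incoming when its edge has orientation `b`, so the half tagged `b`
  -- gets `b` if `inc` holds and `!b` if not. An uncut edge is read off at its end `true`.
  open Classical in if p.1.1 ∈ S then p.1.2 == inc p.1 else inc (p.1.1, true)

end LabelledGraph

/-! ### Semi-orientations of permutation charts -/

open LabelledGraph

/-- The half-edges at each vertex of a permutation chart can be directed with a flow. -/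
lemma PermutationChart.exists_flow {n : ℕ} (Γ : PermutationChart n) :
    ∃ inc : Γ.HalfEdge → Bool, ∀ v ∈ Γ.vertices, Γ.IsBlack v ∨
      (∃ h, Γ.IsCrossing v h ∧ ∀ k, inc (h k) = decide ((k : ℕ) < 2)) ∨
      ∃ h, Γ.IsWhite v h ∧ ∀ k, inc (h k) = decide ((k : ℕ) < 3) := by
  have key : ∀ v : ℂ, ∃ inc : Γ.HalfEdge → Bool, v ∈ Γ.vertices → Γ.IsBlack v ∨
      (∃ h, Γ.IsCrossing v h ∧ ∀ k, inc (h k) = decide ((k : ℕ) < 2)) ∨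
      ∃ h, Γ.IsWhite v h ∧ ∀ k, inc (h k) = decide ((k : ℕ) < 3) := by
    intro v
    by_cases hv : v ∈ Γ.vertices
    · rcases Γ.vertex_type v hv with h | ⟨h, hh⟩ | ⟨h, hh⟩
      · exact ⟨fun _ => true, fun _ => Or.inl h⟩
      -- Making the half-edges `0` and `1` incoming gives opposite half-edges `k`, `k + 2` different
      -- directions.
      · exact ⟨Function.extend h (fun k => decide ((k : ℕ) < 2)) fun _ => true,
          fun _ => Or.inr (Or.inl ⟨h, hh, fun k => hh.2.1.1.extend_apply _ _ k⟩)⟩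
      · exact ⟨Function.extend h (fun k => decide ((k : ℕ) < 3)) fun _ => true,
          fun _ => Or.inr (Or.inr ⟨h, hh, fun k => hh.2.1.1.extend_apply _ _ k⟩)⟩
    · exact ⟨fun _ => true, fun h => absurd h hv⟩
  choose inc hinc using key
  -- Each half-edge belongs to the star of one point only, so the local choices never compete, even
  -- on loops.
  refine ⟨fun x => inc (Γ.germ x 0) x, fun v hv => ?_⟩
  rcases hinc v hv with h | ⟨h, hh, hk⟩ | ⟨h, hh, hk⟩
  · exact Or.inl h
  · exact Or.inr (Or.inl ⟨h, hh, fun k => by simp only [hh.2.1.germ_zero, hk]⟩)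
  · exact Or.inr (Or.inr ⟨h, hh, fun k => by simp only [hh.2.1.germ_zero, hk]⟩)

/-- Every permutation chart has a semi-orientation. -/
theorem PermutationChart.exists_semiOrientation {n : ℕ} (Γ : PermutationChart n) :
    ∃ Γ' : SemiOrientedChart n, IsSemiOrientationOf Γ' Γ := by
  obtain ⟨inc, hinc⟩ := Γ.exists_flow
  -- Equal values at the two ends are the conflicts: an oriented edge is incoming at exactly one
  -- end. Vertex-free closed curves are left uncut.
  let S : Set Γ.Edge := {e | (Γ.arc e 0 ∈ Γ.vertices ∧ Γ.arc e 1 ∈ Γ.vertices) ∧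
    inc (e, false) = inc (e, true)}
  have hS : ∀ e ∈ S, Γ.arc e 0 ∈ Γ.vertices ∧ Γ.arc e 1 ∈ Γ.vertices := fun e he => he.1
  let Δ := Γ.toLabelledGraph.subdivide S hS
  let o : Δ.Edge → Bool := Γ.pieceOrient inc
  have ho : ∀ x : Γ.HalfEdge, Γ.germ x 0 ∈ Γ.vertices →
      (Δ.Incoming o (liftHalf S hS x) ↔ inc x = true) := by
    rintro ⟨e, b⟩ hx
    by_cases he : e ∈ S
    · rw [liftHalf_of_mem he]
      simp only [Incoming, pieceHalf, o, pieceOrient, he, if_true]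
      cases b <;> cases inc _ <;> simp
    · rw [liftHalf_of_notMem he]
      simp only [Incoming, pieceHalf, o, pieceOrient, he, if_false]
      have hv : Γ.arc e 0 ∈ Γ.vertices ∧ Γ.arc e 1 ∈ Γ.vertices := by
        rcases Γ.arc_ends e with h | ⟨h, h'⟩
        · exact h
        · cases b
          · exact absurd (by simpa [germ] using hx) h'
          · exact absurd (by simpa [germ, ← h] using hx) h'
      have hne : inc (e, false) ≠ inc (e, true) := fun h => he ⟨hv, h⟩
      cases b
      · cases h : inc (e, true) <;> cases h' : inc (e, false) <;> simp_all
      · rfl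
  have hg : ∀ {v : ℂ} {k : ℕ} {h : Fin k → Γ.HalfEdge}, v ∈ Γ.vertices → Γ.IsStar v h →
      ∀ i, (Δ.Incoming o ((liftHalf S hS ∘ h) i) ↔ inc (h i) = true) := by
    intro v k h hv hs i
    exact ho _ (hs.germ_zero i ▸ hv)
  have hmid : ∀ e (he : e ∈ S), Δ.IsSource o
        ![pieceHalf hS ⟨(e, false), fun _ => he⟩ true, pieceHalf hS ⟨(e, true), fun _ => he⟩ false] ∨
      Δ.IsSink o
        ![pieceHalf hS ⟨(e, false), fun _ => he⟩ true, pieceHalf hS ⟨(e, true), fun _ => he⟩ false] := by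
    intro e he
    have h : inc (e, false) = inc (e, true) := he.2
    simp only [IsSource, IsSink, Incoming, pieceHalf, o, pieceOrient, he, if_true, Matrix.cons_val_zero,
      Matrix.cons_val_one, h]
    cases inc (e, true) <;> simp
  refine ⟨⟨Δ, o, ?_⟩, support_subdivide (hS := hS),
    fun v hv => (mem_subdivide_vertices (hS := hS)).2 (Or.inl hv), ?_,
    fun p => ⟨p.1.1, edgeSet_subdivide_subset (hS := hS) p, rfl⟩⟩
  · intro v hv
    rcases mem_subdivide_vertices.1 hv with hv | ⟨e, he, rfl⟩
    · rcases hinc v hv with h | ⟨h, hh, hk⟩ | ⟨h, hh, hk⟩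
      · exact Or.inl h.subdivide
      · refine Or.inr (Or.inl ⟨_, hh.subdivide, ?_⟩)
        simp only [CrossingFlow, hg hv hh.2.1, hk]
        decide
      · refine Or.inr (Or.inr (Or.inl ⟨_, hh.subdivide, 0, fun k => ?_⟩))
        rw [hg hv hh.2.1, hk, zero_add, decide_eq_true_eq]
    · exact Or.inr (Or.inr (Or.inr ⟨_, isBivalent_mid he, hmid e he⟩))
  · intro v hv hv'
    rcases (mem_subdivide_vertices (hS := hS)).1 hv with h | ⟨e, he, rfl⟩
    · exact absurd h hv'
    · exact ⟨_, isBivalent_mid (hS := hS) he⟩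

/-! ### Immersions as graphs in charts -/

section Immersions

open Set Filter Topology Manifold

/-- The shear `(u, w) ↦ (u, w - k u)` over an open set on which `k` is continuous. -/
def shear {E F : Type*} [NormedAddCommGroup E] [NormedAddCommGroup F] (k : E → F) (T : Set E)
    (hT : IsOpen T) (hk : ContinuousOn k T) : OpenPartialHomeomorph (E × F) (E × F) where
  toFun p := (p.1, p.2 - k p.1)
  invFun p := (p.1, p.2 + k p.1)
  source := T ×ˢ univ
  target := T ×ˢ univ
  map_source' p hp := ⟨hp.1, trivial⟩
  map_target' p hp := ⟨hp.1, trivial⟩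
  left_inv' p _ := by simp
  right_inv' p _ := by simp
  open_source := hT.prod isOpen_univ
  open_target := hT.prod isOpen_univ
  continuousOn_toFun := continuousOn_fst.prodMk
    (continuousOn_snd.sub (hk.comp continuousOn_fst fun _ hp => hp.1))
  continuousOn_invFun := continuousOn_fst.prodMk
    (continuousOn_snd.add (hk.comp continuousOn_fst fun _ hp => hp.1))

variable {E F E₁ V : Type*} [NormedAddCommGroup E] [NormedSpace ℝ E] [NormedAddCommGroup F]
  [NormedSpace ℝ F] [NormedAddCommGroup E₁] [NormedSpace ℝ E₁] [NormedAddCommGroup V]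
  [NormedSpace ℝ V] {M N : Type*} [TopologicalSpace M] [ChartedSpace E M] [TopologicalSpace N]
  [ChartedSpace (ModelProd E₁ V) N]

/-- A map which is the graph of a smooth function in suitable charts is an immersion. -/
lemma isImmersionAtOfComplement_of_graph [IsManifold (𝓘(ℝ, E₁).prod 𝓘(ℝ, V)) ∞ N]
    (L : (E × F) ≃L[ℝ] (E₁ × V)) {f : M → N} {x : M} (hf : ContinuousAt f x)
    {e : OpenPartialHomeomorph M E} (he : e ∈ IsManifold.maximalAtlas 𝓘(ℝ, E) ∞ M)
    (hx : x ∈ e.source) {χ : OpenPartialHomeomorph N (ModelProd E₁ V)}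
    (hχ : χ ∈ IsManifold.maximalAtlas (𝓘(ℝ, E₁).prod 𝓘(ℝ, V)) ∞ N) (hfx : f x ∈ χ.source)
    {k : E → F} (hk : ContDiffOn ℝ ∞ k e.target)
    (h : ∀ u ∈ e.target, χ (f (e.symm u)) = L (u, k u)) :
    IsImmersionAtOfComplement F 𝓘(ℝ, E) (𝓘(ℝ, E₁).prod 𝓘(ℝ, V)) ∞ f x := by
  -- Conjugating the shear by `L` flattens the graph of `k` to `F`-coordinate `0`; composed with
  -- `χ`, this is the target chart for the immersion normal form.
  let τ : OpenPartialHomeomorph (ModelProd E₁ V) (ModelProd E₁ V) :=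
    L.symm.toHomeomorph.toOpenPartialHomeomorph ≫ₕ
      shear k e.target e.open_target hk.continuousOn ≫ₕ L.toHomeomorph.toOpenPartialHomeomorph
  have hsource : τ.source = {p | (L.symm p).1 ∈ e.target} := by
    ext p
    simp only [τ, shear, mfld_simps]
    rfl
  have htarget : τ.target = {p | (L.symm p).1 ∈ e.target} := by
    ext p
    simp only [τ, shear, mfld_simps]
    rfl
  have hτ : ContDiffOn ℝ ∞ (fun p : E₁ × V => L ((L.symm p).1, (L.symm p).2 - k (L.symm p).1))
      {p | (L.symm p).1 ∈ e.target} := by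
    have := hk.comp (s := {p : E₁ × V | (L.symm p).1 ∈ e.target})
      (L.symm.contDiff.fst.contDiffOn) fun p hp => hp
    exact L.contDiff.comp_contDiffOn
      (L.symm.contDiff.fst.contDiffOn.prodMk (L.symm.contDiff.snd.contDiffOn.sub this))
  have hτ' : ContDiffOn ℝ ∞ (fun p : E₁ × V => L ((L.symm p).1, (L.symm p).2 + k (L.symm p).1))
      {p | (L.symm p).1 ∈ e.target} := by
    have := hk.comp (s := {p : E₁ × V | (L.symm p).1 ∈ e.target})
      (L.symm.contDiff.fst.contDiffOn) fun p hp => hp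
    exact L.contDiff.comp_contDiffOn
      (L.symm.contDiff.fst.contDiffOn.prodMk (L.symm.contDiff.snd.contDiffOn.add this))
  have mτ : ContMDiffOn (𝓘(ℝ, E₁).prod 𝓘(ℝ, V)) (𝓘(ℝ, E₁).prod 𝓘(ℝ, V)) ∞ τ τ.source := by
    rw [hsource, ← modelWithCornersSelf_prod, contMDiffOn_iff_contDiffOn]
    exact hτ
  have mτ' : ContMDiffOn (𝓘(ℝ, E₁).prod 𝓘(ℝ, V)) (𝓘(ℝ, E₁).prod 𝓘(ℝ, V)) ∞ τ.symm τ.target := by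
    rw [htarget, ← modelWithCornersSelf_prod, contMDiffOn_iff_contDiffOn]
    exact hτ'
  have hχf : χ (f x) = L (e x, k (e x)) := by
    have := h (e x) (e.map_source hx)
    rwa [e.left_inv hx] at this
  refine IsImmersionAtOfComplement.mk_of_continuousAt hf L e (χ ≫ₕ τ) hx ?_ he ?_ ?_
  · rw [OpenPartialHomeomorph.trans_source]
    refine ⟨hfx, ?_⟩
    rw [mem_preimage, hχf, hsource]
    change (L.symm (L (e x, k (e x)))).1 ∈ e.target
    rw [L.symm_apply_apply]
    exact e.map_source hx
  · apply OpenPartialHomeomorph.mem_maximalAtlas_of_contMDiffOn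
    · exact mτ.comp ((contMDiffOn_of_mem_maximalAtlas hχ).mono inter_subset_left)
        inter_subset_right
    · exact (contMDiffOn_symm_of_mem_maximalAtlas hχ).comp (mτ'.mono inter_subset_left)
        inter_subset_right
  · intro u hu
    have hu' : u ∈ e.target := by simpa using hu
    have := h u hu'
    change τ (χ (f (e.symm u))) = L (u, 0)
    rw [this]
    simp [τ, shear]

end Immersions

/-! ### Pairs of maps one of which is a local diffeomorphism -/

section LocalDiffeomorphisms

open Set Filter Topology Manifold

variable {E V : Type*} [NormedAddCommGroup E] [NormedSpace ℝ E]
  [NormedAddCommGroup V] [NormedSpace ℝ V] {M N : Type*} [TopologicalSpace M] [ChartedSpace E M]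
  [TopologicalSpace N] [ChartedSpace E N]

/-- If the first component of a smooth map is a local diffeomorphism, then it is an immersion. -/
lemma isImmersionAtOfComplement_prodMk_left [IsManifold 𝓘(ℝ, E) ∞ M] [IsManifold 𝓘(ℝ, E) ∞ N]
    {f : M → N} {g : M → V} {x : M}
    (hf : IsLocalDiffeomorphAt 𝓘(ℝ, E) 𝓘(ℝ, E) ∞ f x) (hg : ContMDiff 𝓘(ℝ, E) 𝓘(ℝ, V) ∞ g) :
    IsImmersionAtOfComplement V 𝓘(ℝ, E) (𝓘(ℝ, E).prod 𝓘(ℝ, V)) ∞ (fun z => (f z, g z)) x := by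
  obtain ⟨Φ, hx, hΦ⟩ := hf
  have hΦx : f x = Φ x := hΦ hx
  have hχ := IsManifold.chart_mem_maximalAtlas (I := 𝓘(ℝ, E)) (n := ∞) (f x)
  set χ := chartAt E (f x)
  -- In the chart pulled back through `f`, the first component becomes the identity and the pair is
  -- the graph of `g`.
  let e : OpenPartialHomeomorph M E := Φ.toOpenPartialHomeomorph ≫ₕ χ
  have he : e ∈ IsManifold.maximalAtlas 𝓘(ℝ, E) ∞ M := by
    apply OpenPartialHomeomorph.mem_maximalAtlas_of_contMDiffOn
    · exact (contMDiffOn_of_mem_maximalAtlas hχ).comp (Φ.contMDiffOn_toFun.mono inter_subset_left)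
        inter_subset_right
    · exact Φ.contMDiffOn_invFun.comp
        ((contMDiffOn_symm_of_mem_maximalAtlas hχ).mono inter_subset_left) inter_subset_right
  have hxe : x ∈ e.source := ⟨hx, by
    change Φ x ∈ χ.source
    rw [← hΦx]
    exact mem_chart_source E (f x)⟩
  refine isImmersionAtOfComplement_of_graph (ContinuousLinearEquiv.refl ℝ (E × V))
    (e := e) (χ := χ.prod (OpenPartialHomeomorph.refl V)) (k := g ∘ e.symm) ?_ he hxe ?_ ?_ ?_ ?_
  · refine ContinuousAt.prodMk ?_ hg.continuous.continuousAt
    exact ((Φ.contMDiffOn_toFun.continuousOn.congr hΦ).continuousAt (Φ.open_source.mem_nhds hx))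
  · exact IsManifold.mem_maximalAtlas_prod hχ (IsManifold.chart_mem_maximalAtlas (0 : V))
  · exact ⟨mem_chart_source E (f x), trivial⟩
  · rw [← contMDiffOn_iff_contDiffOn]
    exact hg.comp_contMDiffOn (contMDiffOn_symm_of_mem_maximalAtlas he)
  · intro u hu
    have h1 : e.symm u ∈ e.source := e.map_target hu
    have h2 : e (e.symm u) = u := e.right_inv hu
    change (χ (f (e.symm u)), g (e.symm u)) = (u, g (e.symm u))
    rw [hΦ h1.1]
    exact congrArg (fun w => (w, g (e.symm u))) h2

/-- If the second component of a smooth map is a local diffeomorphism, then it is an immersion. -/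
lemma isImmersionAtOfComplement_prodMk_right [IsManifold 𝓘(ℝ, E) ∞ M] [IsManifold 𝓘(ℝ, E) ∞ N]
    (A : E ≃L[ℝ] V) {f : M → N} {g : M → V} {x : M} (hf : ContMDiff 𝓘(ℝ, E) 𝓘(ℝ, E) ∞ f)
    (hg : IsLocalDiffeomorphAt 𝓘(ℝ, E) 𝓘(ℝ, V) ∞ g x) :
    IsImmersionAtOfComplement V 𝓘(ℝ, E) (𝓘(ℝ, E).prod 𝓘(ℝ, V)) ∞ (fun z => (f z, g z)) x := by
  obtain ⟨Ψ, hx, hΨ⟩ := hg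
  have hχ := IsManifold.chart_mem_maximalAtlas (I := 𝓘(ℝ, E)) (n := ∞) (f x)
  set χ := chartAt E (f x)
  have hs : IsOpen (f ⁻¹' χ.source) := χ.open_source.preimage hf.continuous
  let e : OpenPartialHomeomorph M E :=
    (Ψ.toOpenPartialHomeomorph.restrOpen _ hs) ≫ₕ A.symm.toHomeomorph.toOpenPartialHomeomorph
  have hes : e.source ⊆ Ψ.source ∩ f ⁻¹' χ.source := fun z hz => hz.1
  have he : e ∈ IsManifold.maximalAtlas 𝓘(ℝ, E) ∞ M := by
    apply OpenPartialHomeomorph.mem_maximalAtlas_of_contMDiffOn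
    · exact A.symm.contDiff.contMDiff.comp_contMDiffOn
        (Ψ.contMDiffOn_toFun.mono fun z hz => (hes hz).1)
    · refine Ψ.contMDiffOn_invFun.comp A.contDiff.contMDiff.contMDiffOn fun u hu => ?_
      exact hu.2.1
  have hxe : x ∈ e.source := ⟨⟨hx, mem_chart_source E (f x)⟩, trivial⟩
  -- Here `g` itself, read through `A.symm`, is the chart, and `L` swaps the factors. Applying `A`
  -- to `χ ∘ f` puts the graph function in `V`, so that the complement is the same as when `f` is
  -- the local diffeomorphism.
  refine isImmersionAtOfComplement_of_graph
    (((ContinuousLinearEquiv.prodComm ℝ E V).trans (A.symm.prodCongr A)))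
    (e := e) (χ := χ.prod (OpenPartialHomeomorph.refl V)) (k := fun u => A (χ (f (e.symm u))))
    ?_ he hxe ?_ ?_ ?_ ?_
  · refine hf.continuous.continuousAt.prodMk ?_
    exact ((Ψ.contMDiffOn_toFun.continuousOn.congr hΨ).continuousAt (Ψ.open_source.mem_nhds hx))
  · exact IsManifold.mem_maximalAtlas_prod hχ (IsManifold.chart_mem_maximalAtlas (0 : V))
  · exact ⟨mem_chart_source E (f x), trivial⟩
  · rw [← contMDiffOn_iff_contDiffOn]
    refine A.contDiff.contMDiff.comp_contMDiffOn ?_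
    refine (contMDiffOn_of_mem_maximalAtlas hχ).comp
      (hf.comp_contMDiffOn (contMDiffOn_symm_of_mem_maximalAtlas he)) fun u hu => ?_
    exact (hes (e.map_target hu)).2
  · intro u hu
    have h1 : e.symm u ∈ e.source := e.map_target hu
    have h2 : A.symm (Ψ (e.symm u)) = u := e.right_inv hu
    change (χ (f (e.symm u)), g (e.symm u)) = (A.symm (A (χ (f (e.symm u)))), A u)
    rw [hΨ (hes h1).1, A.symm_apply_apply, ← h2, A.apply_symm_apply, h2]

end LocalDiffeomorphisms

/-! ### Squaring, affine maps, and local diffeomorphisms at finitely many points -/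

section LocalDiffeomorphismTools

open Set Filter Topology Manifold

lemma _root_.IsLocalDiffeomorphAt.congr_of_eventuallyEq {𝕜 E F H H' M N : Type*}
    [NontriviallyNormedField 𝕜] [NormedAddCommGroup E] [NormedSpace 𝕜 E] [NormedAddCommGroup F]
    [NormedSpace 𝕜 F] [TopologicalSpace H] [TopologicalSpace H'] {I : ModelWithCorners 𝕜 E H}
    {J : ModelWithCorners 𝕜 F H'} [TopologicalSpace M] [ChartedSpace H M] [TopologicalSpace N]
    [ChartedSpace H' N] {n : WithTop ℕ∞} {f g : M → N} {x : M}
    (hf : IsLocalDiffeomorphAt I J n f x) (h : g =ᶠ[𝓝 x] f) : IsLocalDiffeomorphAt I J n g x := by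
  obtain ⟨Φ, hx, hΦ⟩ := hf
  obtain ⟨s, hs, hso, hxs⟩ := mem_nhds_iff.1 h
  let e := Φ.toOpenPartialHomeomorph.restrOpen s hso
  refine ⟨⟨e.toPartialEquiv, e.open_source, e.open_target,
    Φ.contMDiffOn_toFun.mono inter_subset_left, Φ.contMDiffOn_invFun.mono inter_subset_left⟩,
    ⟨hx, hxs⟩, fun z hz => ?_⟩
  exact (hs hz.2).trans (hΦ hz.1)

/-- The map `z ↦ z ^ 2` of the plane is a local diffeomorphism away from the origin. -/
lemma isLocalDiffeomorphAt_sq {z₀ : ℂ} (hz₀ : z₀ ≠ 0) :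
    IsLocalDiffeomorphAt 𝓘(ℝ, ℂ) 𝓘(ℝ, ℂ) ∞ (fun z : ℂ => z ^ 2) z₀ := by
  have hopen : IsOpen {w : ℂ | w / z₀ ^ 2 ∈ Complex.slitPlane} :=
    Complex.isOpen_slitPlane.preimage (by fun_prop)
  have hre : ∀ w ∈ Complex.slitPlane, 0 < (w ^ (2⁻¹ : ℂ)).re := by
    intro w hw
    rw [Complex.cpow_def_of_ne_zero (Complex.slitPlane_ne_zero hw), Complex.exp_re]
    refine mul_pos (Real.exp_pos _) (Real.cos_pos_of_mem_Ioo ?_)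
    have him : (Complex.log w * 2⁻¹).im = Complex.arg w / 2 := by
      rw [← div_eq_mul_inv, Complex.div_ofNat_im, Complex.log_im]
    rw [him]
    have h1 := Complex.neg_pi_lt_arg w
    have h2 := (Complex.arg_le_pi w).lt_of_ne (Complex.mem_slitPlane_iff_arg.1 hw).1
    constructor <;> linarith
  have hsq : ∀ u : ℂ, 0 < u.re → u ^ 2 ∈ Complex.slitPlane := by
    intro u hu
    rw [Complex.mem_slitPlane_iff]
    by_cases h : u.im = 0
    · left
      simp only [sq, Complex.mul_re, h]
      nlinarith
    · right
      simp only [sq, Complex.mul_im]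
      intro h'
      have : u.re * u.im = 0 := by linarith
      rcases mul_eq_zero.1 this with h'' | h''
      · exact hu.ne' h''
      · exact h h''
  -- Dividing by `z₀` moves the base point to `1`, where squaring maps the right half-plane onto the
  -- slit plane, with the principal square root as inverse.
  let Φ : PartialDiffeomorph 𝓘(ℝ, ℂ) 𝓘(ℝ, ℂ) ℂ ℂ ∞ :=
    { toFun := fun z => z ^ 2
      invFun := fun w => z₀ * (w / z₀ ^ 2) ^ (2⁻¹ : ℂ)
      source := {z | 0 < (z / z₀).re}
      target := {w | w / z₀ ^ 2 ∈ Complex.slitPlane}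
      map_source' := by
        intro z hz
        change z ^ 2 / z₀ ^ 2 ∈ Complex.slitPlane
        rw [← div_pow]
        exact hsq _ hz
      map_target' := by
        intro w hw
        change 0 < (z₀ * (w / z₀ ^ 2) ^ (2⁻¹ : ℂ) / z₀).re
        rw [mul_div_cancel_left₀ _ hz₀]
        exact hre _ hw
      left_inv' := by
        intro z hz
        rw [← div_pow, Complex.sq_cpow_two_inv hz, mul_div_cancel₀ _ hz₀]
      right_inv' := by
        intro w hw
        rw [mul_pow, Complex.cpow_ofNat_inv_pow, mul_div_cancel₀ _ (pow_ne_zero 2 hz₀)]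
      open_source := isOpen_lt continuous_const (by fun_prop)
      open_target := hopen
      contMDiffOn_toFun := (contDiff_id.pow 2).contMDiff.contMDiffOn
      contMDiffOn_invFun := by
        rw [contMDiffOn_iff_contDiffOn]
        have : DifferentiableOn ℂ (fun w => z₀ * (w / z₀ ^ 2) ^ (2⁻¹ : ℂ))
            {w : ℂ | w / z₀ ^ 2 ∈ Complex.slitPlane} := fun w hw =>
          (((differentiableAt_id.div_const _).cpow_const hw).const_mul _).differentiableWithinAt
        exact (this.contDiffOn hopen).restrict_scalars ℝ }
  refine ⟨Φ, ?_, fun z _ => rfl⟩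
  change 0 < (z₀ / z₀).re
  rw [div_self hz₀]
  norm_num

/-- An affine isomorphism is a local diffeomorphism. -/
lemma isLocalDiffeomorphAt_affine {E V : Type*} [NormedAddCommGroup E] [NormedSpace ℝ E]
    [NormedAddCommGroup V] [NormedSpace ℝ V] (A : E ≃L[ℝ] V) {δ : ℝ} (hδ : δ ≠ 0) (c : V) (x : E) :
    IsLocalDiffeomorphAt 𝓘(ℝ, E) 𝓘(ℝ, V) ∞ (fun u => c + δ • A u) x :=
  ⟨{toFun := fun u => c + δ • A u
    invFun := fun v => A.symm (δ⁻¹ • (v - c))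
    source := univ
    target := univ
    map_source' := fun _ _ => trivial
    map_target' := fun _ _ => trivial
    left_inv' := fun u _ => by simp [hδ]
    right_inv' := fun v _ => by simp [hδ]
    open_source := isOpen_univ
    open_target := isOpen_univ
    contMDiffOn_toFun :=
      (contDiff_const.add (contDiff_const.smul A.contDiff)).contMDiff.contMDiffOn
    contMDiffOn_invFun := (A.symm.contDiff.comp
      (contDiff_const.smul (contDiff_id.sub contDiff_const))).contMDiff.contMDiffOn},
    trivial, fun _ _ => rfl⟩

variable {E : Type*} [NormedAddCommGroup E] [NormedSpace ℝ E] {M : Type*} [TopologicalSpace M]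
  [ChartedSpace E M] [IsManifold 𝓘(ℝ, E) ∞ M]

lemma isLocalDiffeomorphAt_chartAt (x : M) :
    IsLocalDiffeomorphAt 𝓘(ℝ, E) 𝓘(ℝ, E) ∞ (chartAt E x) x :=
  ⟨{(chartAt E x) with
    contMDiffOn_toFun := contMDiffOn_chart
    contMDiffOn_invFun := contMDiffOn_chart_symm}, mem_chart_source E x, fun _ _ => rfl⟩

/-- There is a smooth map into the model space which is a local diffeomorphism at finitely many
given points. -/
lemma exists_contMDiff_isLocalDiffeomorphAt [FiniteDimensional ℝ E] [T2Space M] {C : Set M}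
    (hC : C.Finite) :
    ∃ g : M → E, ContMDiff 𝓘(ℝ, E) 𝓘(ℝ, E) ∞ g ∧
      ∀ x ∈ C, IsLocalDiffeomorphAt 𝓘(ℝ, E) 𝓘(ℝ, E) ∞ g x := by
  obtain ⟨U, hU, hd⟩ := hC.t2_separation
  have hb : ∀ c : M, ∃ b : SmoothBumpFunction 𝓘(ℝ, E) c, tsupport b ⊆ U c := fun c => by
    obtain ⟨b, -, hb⟩ := (SmoothBumpFunction.nhds_basis_tsupport (I := 𝓘(ℝ, E)) c).mem_iff.1
      ((hU c).2.mem_nhds (hU c).1)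
    exact ⟨b, hb⟩
  choose b hb using hb
  -- The supports lie in disjoint neighbourhoods, so near a point of `C` only its own bump function
  -- survives; it equals `1` there, and the sum is the chart.
  refine ⟨fun x => ∑ c ∈ hC.toFinset, b c x • chartAt E c x, ?_, fun x hx => ?_⟩
  · exact contMDiff_finsetSum fun c _ => (b c).contMDiff_smul contMDiffOn_chart
  · refine (isLocalDiffeomorphAt_chartAt x).congr_of_eventuallyEq ?_
    filter_upwards [(b x).eventuallyEq_one, (hU x).2.mem_nhds (hU x).1] with z hz hzU
    rw [Finset.sum_eq_single x]
    · rw [hz, Pi.one_apply, one_smul]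
    · intro c hc hcx
      have hzc : b c z = 0 := image_eq_zero_of_notMem_tsupport fun hzc =>
        (hd (hC.mem_toFinset.1 hc) hx hcx).le_bot ⟨hb c hzc, hzU⟩
      rw [hzc, zero_smul]
    · exact fun h => absurd (hC.mem_toFinset.2 hx) h

end LocalDiffeomorphismTools

/-! ### Immersed foldings of simple branched covers -/

section Covers

open Set Filter Topology Manifold

variable {M : Type*} [TopologicalSpace M] [ChartedSpace (EuclideanSpace ℝ (Fin 2)) M]

lemma DiffeoOn.isLocalDiffeomorphAt {f : M → S2} {U : Set M} {N : Set S2} (h : DiffeoOn f U N)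
    {x : M} (hx : x ∈ U) : IsLocalDiffeomorphAt (𝓡 2) (𝓡 2) ∞ f x := by
  obtain ⟨Φ, rfl, -, hf⟩ := h
  exact ⟨Φ, hx, hf⟩

lemma IsRegularPoint.exists_nhds {n : ℕ} {f : M → S2} {y : S2} (h : IsRegularPoint n f y) :
    ∃ N ∈ 𝓝 y, ∀ x ∈ f ⁻¹' N, IsLocalDiffeomorphAt (𝓡 2) (𝓡 2) ∞ f x := by
  obtain ⟨N, hN, hy, U, hU, -, hf⟩ := h
  refine ⟨N, hN.mem_nhds hy, fun x hx => ?_⟩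
  obtain ⟨j, hj⟩ := mem_iUnion.1 (hU ▸ hx)
  exact (hf j).isLocalDiffeomorphAt hj

/-- Near the fibre of a branch point, a branched cover is smooth, and it is a local diffeomorphism
except at one point. -/
lemma IsBranchPoint.exists_nhds {n : ℕ} {f : M → S2} {y : S2} (h : IsBranchPoint n f y) :
    ∃ N ∈ 𝓝 y, ∃ c : M, ∀ x ∈ f ⁻¹' N, ContMDiffAt (𝓡 2) (𝓡 2) ∞ f x ∧
      (x ≠ c → IsLocalDiffeomorphAt (𝓡 2) (𝓡 2) ∞ f x) := by
  obtain ⟨-, N, hN, hy, U, W, hU, -, -, hf, φ, ψ, rfl, hφt, -, rfl, hψt, hfW⟩ := h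
  -- The exceptional point is the origin of the sheet on which the cover is squaring.
  refine ⟨φ.source, hN.mem_nhds hy, ψ.symm 0, fun x hx => ?_⟩
  by_cases hxW : x ∈ ψ.source
  swap
  · obtain ⟨j, hj⟩ := mem_iUnion.1 ((hU ▸ hx : x ∈ (⋃ j, U j) ∪ ψ.source).resolve_right hxW)
    have := (hf j).isLocalDiffeomorphAt hj
    exact ⟨this.contMDiffAt, fun _ => this⟩
  have hsub : ψ.source ⊆ f ⁻¹' φ.source := hU ▸ subset_union_right
  have heq : f =ᶠ[𝓝 x] φ.symm ∘ (fun z : ℂ => z ^ 2) ∘ ψ := by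
    filter_upwards [ψ.open_source.mem_nhds hxW] with z hz
    change f z = φ.symm (ψ z ^ 2)
    rw [← hfW z hz]
    exact (φ.left_inv (hsub hz)).symm
  have hψ : IsLocalDiffeomorphAt (𝓡 2) 𝓘(ℝ, ℂ) ∞ ψ x := ψ.isLocalDiffeomorphAt _ _ _ hxW
  have hφ : IsLocalDiffeomorphAt 𝓘(ℝ, ℂ) (𝓡 2) ∞ φ.symm (ψ x ^ 2) := by
    refine φ.symm.isLocalDiffeomorphAt _ _ _ ?_
    rw [← hfW x hxW]
    exact φ.map_source hx
  constructor
  · refine ContMDiffAt.congr_of_eventuallyEq ?_ heq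
    have hsq : ContMDiff 𝓘(ℝ, ℂ) 𝓘(ℝ, ℂ) ∞ (fun z : ℂ => z ^ 2) := (contDiff_id.pow 2).contMDiff
    exact hφ.contMDiffAt.comp x (hsq.contMDiffAt.comp x hψ.contMDiffAt)
  · intro hxc
    have h0 : ψ x ≠ 0 := fun h => hxc (h ▸ (ψ.left_inv hxW).symm)
    exact ((hψ.comp _ _ (isLocalDiffeomorphAt_sq h0)).comp _ _ hφ).congr_of_eventuallyEq heq

/-- A simple branched cover is smooth, and it is a local diffeomorphism off a finite set. -/
lemma IsSimpleBranchedCover.contMDiff_and_isLocalDiffeomorphAt {n : ℕ} {f : M → S2}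
    (h : IsSimpleBranchedCover n f) :
    ContMDiff (𝓡 2) (𝓡 2) ∞ f ∧
      ∃ C : Set M, C.Finite ∧ ∀ x ∉ C, IsLocalDiffeomorphAt (𝓡 2) (𝓡 2) ∞ f x := by
  have key : ∀ y, ∃ N ∈ 𝓝 y, ∃ C : Set M, C.Finite ∧ ∀ x ∈ f ⁻¹' N,
      ContMDiffAt (𝓡 2) (𝓡 2) ∞ f x ∧ (x ∉ C → IsLocalDiffeomorphAt (𝓡 2) (𝓡 2) ∞ f x) := by
    intro y
    rcases h.2 y with h | h
    · obtain ⟨N, hN, hf⟩ := h.exists_nhds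
      exact ⟨N, hN, ∅, finite_empty, fun x hx => ⟨(hf x hx).contMDiffAt, fun _ => hf x hx⟩⟩
    · obtain ⟨N, hN, c, hf⟩ := h.exists_nhds
      exact ⟨N, hN, {c}, finite_singleton c, hf⟩
  choose N hN C hC hf using key
  -- Compactness of the sphere: finitely many of the `N y` cover it, and each `C y` is finite.
  obtain ⟨s, hs⟩ := finite_cover_nhds hN
  have hmem : ∀ x, ∃ y ∈ s, x ∈ f ⁻¹' N y := fun x => by
    have : f x ∈ ⋃ y ∈ s, N y := hs ▸ mem_univ _
    simpa using this
  refine ⟨fun x => ?_, ⋃ y ∈ s, C y, s.finite_toSet.biUnion fun y _ => hC y, fun x hx => ?_⟩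
  · obtain ⟨y, -, hy⟩ := hmem x
    exact (hf y x hy).1
  · obtain ⟨y, hys, hy⟩ := hmem x
    exact (hf y x hy).2 fun hxy => hx (mem_biUnion hys hxy)

/-- A simple branched cover has an immersed folding in the product of the sphere with any plane
region with nonempty interior. -/
theorem IsSimpleBranchedCover.exists_immersedFolding [T2Space M] [CompactSpace M]
    [IsManifold (𝓡 2) ∞ M] {n : ℕ} {f : M → S2} (h : IsSimpleBranchedCover n f) {V : Type}
    [NormedAddCommGroup V] [NormedSpace ℝ V] (A : EuclideanSpace ℝ (Fin 2) ≃L[ℝ] V) {K : Set V}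
    (hK : (interior K).Nonempty) : ∃ F : M → S2 × V, IsImmersedFolding f K F := by
  obtain ⟨hf, C, hC, hfC⟩ := h.contMDiff_and_isLocalDiffeomorphAt
  obtain ⟨g, hg, hgC⟩ := exists_contMDiff_isLocalDiffeomorphAt (E := EuclideanSpace ℝ (Fin 2)) hC
  obtain ⟨c, hc⟩ := hK
  obtain ⟨ε, hε, hεK⟩ := Metric.mem_nhds_iff.1 (mem_interior_iff_mem_nhds.1 hc)
  obtain ⟨R, hR, hgR⟩ :=
    (isCompact_range (A.continuous.comp hg.continuous)).isBounded.exists_pos_norm_lt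
  have hδ : 0 < ε / R := div_pos hε hR
  -- Since `R` bounds `A ∘ g` strictly, the factor `ε / R` brings the image into the `ε`-ball about
  -- `c` inside `K`; being nonzero, it preserves local diffeomorphisms. An immersion needs one
  -- complement for all points, here `V`.
  refine ⟨fun x => (f x, c + (ε / R) • A (g x)), ⟨V, inferInstance, inferInstance, fun x => ?_⟩,
    fun _ => rfl, fun x => hεK ?_⟩
  · by_cases hx : x ∈ C
    · exact isImmersionAtOfComplement_prodMk_right A hf
        ((hgC x hx).comp _ _ (isLocalDiffeomorphAt_affine A hδ.ne' c (g x)))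
    · refine isImmersionAtOfComplement_prodMk_left (hfC x hx) ?_
      exact (contDiff_const.add (contDiff_const.smul A.contDiff)).contMDiff.comp hg
  · have hgx := hgR (A (g x)) ⟨x, rfl⟩
    rw [mem_ball_iff_norm, add_sub_cancel_left, norm_smul, Real.norm_of_nonneg hδ.le,
      div_mul_eq_mul_div, div_lt_iff₀ hR]
    exact mul_lt_mul_of_pos_left hgx hε

end Covers

end Folding

theorem mainTheorem6 :
    -- every permutation chart can be semi-oriented
    (∀ (n : ℕ) (Γ : Folding.PermutationChart n),
      ∃ Γ' : Folding.SemiOrientedChart n, Folding.IsSemiOrientationOf Γ' Γ) ∧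
    -- the cover associated with a semi-oriented chart has an immersed folding in S² × [0,1] × [0,1]
    (∀ (n : ℕ) (Γ' : Folding.SemiOrientedChart n)
      (M : Type*) [TopologicalSpace M] [T2Space M] [CompactSpace M]
      [ChartedSpace (EuclideanSpace ℝ (Fin 2)) M] [IsManifold (𝓡 2) ∞ M] (f : M → Folding.S2),
      Folding.IsAssociatedCover Γ'.toLabelledGraph f →
      ∃ F : M → Folding.S2 × (ℝ × ℝ),
        Folding.IsImmersedFolding f (Set.Icc (0 : ℝ) 1 ×ˢ Set.Icc (0 : ℝ) 1) F) ∧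
    -- every 3-fold simple branched cover of S² has an immersed folding in S² × D²
    (∀ (M : Type*) [TopologicalSpace M] [T2Space M] [CompactSpace M]
      [ChartedSpace (EuclideanSpace ℝ (Fin 2)) M] [IsManifold (𝓡 2) ∞ M] (f : M → Folding.S2),
      Folding.IsSimpleBranchedCover 3 f →
      ∃ F : M → Folding.S2 × EuclideanSpace ℝ (Fin 2),
        Folding.IsImmersedFolding f (Metric.closedBall 0 1) F) := by
  refine ⟨fun n Γ => Γ.exists_semiOrientation, ?_, ?_⟩
  · intro n Γ' M _ _ _ _ _ f hf
    refine hf.1.exists_immersedFolding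
      (ContinuousLinearEquiv.ofFinrankEq (by simp)) ⟨(1 / 2, 1 / 2), ?_⟩
    rw [interior_prod_eq, interior_Icc]
    norm_num
  · intro M _ _ _ _ _ f hf
    refine hf.exists_immersedFolding (ContinuousLinearEquiv.refl ℝ _) ⟨0, ?_⟩
    exact Metric.ball_subset_interior_closedBall (Metric.mem_ball_self one_pos)
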